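/- Let $(M,g,K)$ be a statistical manifold: $M$ is a smooth $n$-dimensional manifold, $g$ a smooth Riemannian metric with Levi-Civita connection $\hat\nabla$, and $K$ a smooth $(1,2)$-tensor field such that $C(X,Y,Z):=g(K(X,Y),Z)$ is symmetric in $X,Y,Z$. Write $K_XY=K(X,Y)$. Assume that $K$ is non-degenerate, i.e. $X\mapsto K_X$ is injective on every tangent space, and that $[K,K]=0$, i.e. $K_XK_YZ=K_YK_XZ$ for all $X,Y,Z$. Let $E=\mathrm{tr}_gK$ be the vector field with components $E^h=g^{ij}K_{ij}^h$. A canonical frame on an open set $U\subseteq M$ is a family $u_1,\dots,u_n$ of smooth vector fields on $U$ that form a basis of each tangent space $T_xM$, $x\in U$, and satisfy $K(u_i,u_i)=u_i$ and $K(u_i,u_j)=0$ for $i\ne j$. Then every point of $M$ has an open neighbourhood with a canonical frame, and the following two conditions are equivalent: (a) the $(0,4)$-tensor $\hat\nabla C$ is totally symmetric and $\hat\nabla E=0$; (b) $\hat\nabla C=0$, and for every canonical frame $u_1,\dots,u_n$ on a connected open set the functions $g(u_i,u_i)$, $1\le i\le n$, are constant. -/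

import Mathlib

open Bundle
open scoped Manifold ContDiff Topology

noncomputable section

namespace StatGeom

section LeviCivita

set_option linter.unusedSectionVars false

variable {E : Type*} [NormedAddCommGroup E] [NormedSpace ℝ E] [FiniteDimensional ℝ E]
  {H : Type*} [TopologicalSpace H] {I : ModelWithCorners ℝ E H}
  {M : Type*} [TopologicalSpace M] [ChartedSpace H M] [IsManifold I ∞ M]
  (g : ContMDiffRiemannianMetric I ∞ E (fun x : M ↦ TangentSpace I x))

/-- Right-hand side of the Koszul formula, as a function of vector fields. -/
def koszul (Y X Z : Π x : M, TangentSpace I x) (x : M) : ℝ :=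
  mvfderiv I (fun y ↦ g.inner y (Y y) (Z y)) x (X x)
    + mvfderiv I (fun y ↦ g.inner y (X y) (Z y)) x (Y x)
    - mvfderiv I (fun y ↦ g.inner y (X y) (Y y)) x (Z x)
    + g.inner x (VectorField.mlieBracket I X Y x) (Z x)
    - g.inner x (VectorField.mlieBracket I X Z x) (Y x)
    - g.inner x (VectorField.mlieBracket I Y Z x) (X x)

theorem mdifferentiableAt_metric {X Y : Π x : M, TangentSpace I x} {x : M}
    (hX : MDiffAt (T% X) x) (hY : MDiffAt (T% Y) x) :
    MDiffAt (fun y ↦ g.inner y (X y) (Y y)) x := by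
  have := MDifferentiableAt.clm_bundle_apply₂ (b := fun y : M ↦ y)
    (F₁ := E) (F₂ := E) (F₃ := ℝ) (E₃ := Bundle.Trivial M ℝ)
    ((g.contMDiff x).mdifferentiableAt (by simp)) hX hY
  simp only [mdifferentiableAt_totalSpace] at this
  exact this.2

theorem mvfderiv_metric_smul_left {X Y : Π x : M, TangentSpace I x} {f : M → ℝ} {x : M}
    (hf : MDiffAt f x) (hX : MDiffAt (T% X) x) (hY : MDiffAt (T% Y) x) (v : TangentSpace I x) :
    mvfderiv I (fun y ↦ g.inner y ((f • X) y) (Y y)) x v =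
      f x * mvfderiv I (fun y ↦ g.inner y (X y) (Y y)) x v
        + g.inner x (X x) (Y x) * mvfderiv I f x v := by
  have := congr($(mvfderiv_fun_mul hf (mdifferentiableAt_metric g hX hY)) v)
  simpa using this

theorem mvfderiv_metric_add_left {X X' Y : Π x : M, TangentSpace I x} {x : M}
    (hX : MDiffAt (T% X) x) (hX' : MDiffAt (T% X') x) (hY : MDiffAt (T% Y) x)
    (v : TangentSpace I x) :
    mvfderiv I (fun y ↦ g.inner y ((X + X') y) (Y y)) x v =
      mvfderiv I (fun y ↦ g.inner y (X y) (Y y)) x v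
        + mvfderiv I (fun y ↦ g.inner y (X' y) (Y y)) x v := by
  have := congr($(mvfderiv_fun_add (mdifferentiableAt_metric g hX hY)
    (mdifferentiableAt_metric g hX' hY)) v)
  simpa using this

theorem metric_comm (X Y : Π x : M, TangentSpace I x) :
    (fun y ↦ g.inner y (X y) (Y y)) = fun y ↦ g.inner y (Y y) (X y) :=
  funext fun y ↦ g.symm y (X y) (Y y)

theorem mvfderiv_metric_smul_right {X Y : Π x : M, TangentSpace I x} {f : M → ℝ} {x : M}
    (hf : MDiffAt f x) (hX : MDiffAt (T% X) x) (hY : MDiffAt (T% Y) x) (v : TangentSpace I x) :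
    mvfderiv I (fun y ↦ g.inner y (X y) ((f • Y) y)) x v =
      f x * mvfderiv I (fun y ↦ g.inner y (X y) (Y y)) x v
        + g.inner x (X x) (Y x) * mvfderiv I f x v := by
  rw [metric_comm g X (f • Y), mvfderiv_metric_smul_left g hf hY hX, metric_comm g X Y, g.symm]

theorem mvfderiv_metric_add_right {X Y Y' : Π x : M, TangentSpace I x} {x : M}
    (hX : MDiffAt (T% X) x) (hY : MDiffAt (T% Y) x) (hY' : MDiffAt (T% Y') x)
    (v : TangentSpace I x) :
    mvfderiv I (fun y ↦ g.inner y (X y) ((Y + Y') y)) x v =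
      mvfderiv I (fun y ↦ g.inner y (X y) (Y y)) x v
        + mvfderiv I (fun y ↦ g.inner y (X y) (Y' y)) x v := by
  rw [metric_comm g X (Y + Y'), mvfderiv_metric_add_left g hY hY' hX, metric_comm g X Y,
    metric_comm g X Y']

theorem tensorialAt_koszul_left {Y Z : Π x : M, TangentSpace I x} {x : M}
    (hY : MDiffAt (T% Y) x) (hZ : MDiffAt (T% Z) x) :
    TensorialAt I E (fun X ↦ koszul g Y X Z x) x where
  smul {f X} hf hX := by
    simp only [koszul]
    rw [mvfderiv_metric_smul_left g hf hX hZ, mvfderiv_metric_smul_left g hf hX hY,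
      VectorField.mlieBracket_smul_left hf hX, VectorField.mlieBracket_smul_left hf hX]
    simp
    ring
  add {X X'} hX hX' := by
    simp only [koszul]
    rw [mvfderiv_metric_add_left g hX hX' hZ, mvfderiv_metric_add_left g hX hX' hY,
      VectorField.mlieBracket_add_left hX hX', VectorField.mlieBracket_add_left hX hX']
    simp
    ring

theorem tensorialAt_koszul_right {Y X : Π x : M, TangentSpace I x} {x : M}
    (hY : MDiffAt (T% Y) x) (hX : MDiffAt (T% X) x) :
    TensorialAt I E (fun Z ↦ koszul g Y X Z x) x where
  smul {f Z} hf hZ := by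
    simp only [koszul]
    rw [mvfderiv_metric_smul_right g hf hY hZ, mvfderiv_metric_smul_right g hf hX hZ,
      VectorField.mlieBracket_smul_right hf hZ, VectorField.mlieBracket_smul_right hf hZ]
    simp only [map_add, map_smul, add_apply, smul_apply,
      smul_eq_mul, Pi.smul_apply']
    rw [g.symm x (Z x) (Y x), g.symm x (Z x) (X x)]
    ring
  add {Z Z'} hZ hZ' := by
    simp only [koszul]
    rw [mvfderiv_metric_add_right g hY hZ hZ', mvfderiv_metric_add_right g hX hZ hZ',
      VectorField.mlieBracket_add_right hZ hZ', VectorField.mlieBracket_add_right hZ hZ']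
    simp only [map_add, add_apply, Pi.add_apply]
    ring

/-- In the differentiated field the Koszul expression is additive. -/
theorem koszul_add {Y Y' X Z : Π x : M, TangentSpace I x} {x : M}
    (hY : MDiffAt (T% Y) x) (hY' : MDiffAt (T% Y') x) (hX : MDiffAt (T% X) x)
    (hZ : MDiffAt (T% Z) x) :
    koszul g (Y + Y') X Z x = koszul g Y X Z x + koszul g Y' X Z x := by
  simp only [koszul]
  rw [mvfderiv_metric_add_left g hY hY' hZ, mvfderiv_metric_add_right g hX hY hY',
    VectorField.mlieBracket_add_left hY hY', VectorField.mlieBracket_add_right hY hY']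
  simp only [map_add, add_apply, Pi.add_apply]
  ring

/-- In the differentiated field the Koszul expression satisfies the Leibniz rule. -/
theorem koszul_smul {Y X Z : Π x : M, TangentSpace I x} {f : M → ℝ} {x : M}
    (hf : MDiffAt f x) (hY : MDiffAt (T% Y) x) (hX : MDiffAt (T% X) x)
    (hZ : MDiffAt (T% Z) x) :
    koszul g (f • Y) X Z x
      = f x * koszul g Y X Z x + 2 * (mvfderiv I f x (X x) * g.inner x (Y x) (Z x)) := by
  simp only [koszul]
  rw [mvfderiv_metric_smul_left g hf hY hZ, mvfderiv_metric_smul_right g hf hX hY,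
    VectorField.mlieBracket_smul_left hf hY, VectorField.mlieBracket_smul_right hf hY]
  simp only [map_add, map_smul, add_apply, smul_apply,
    smul_eq_mul, Pi.smul_apply', map_neg, neg_apply, neg_smul]
  rw [g.symm x (X x) (Y x)]
  ring

/-- The Koszul expression at a point, as a bilinear form in the two tensorial arguments. -/
def koszulForm (Y : Π x : M, TangentSpace I x) (x : M) (hY : MDiffAt (T% Y) x) :
    TangentSpace I x →L[ℝ] TangentSpace I x →L[ℝ] ℝ :=
  TensorialAt.mkHom₂ (fun X Z ↦ koszul g Y X Z x) x
    (fun _ hZ ↦ tensorialAt_koszul_left g hY hZ) (fun _ hX ↦ tensorialAt_koszul_right g hY hX)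

theorem koszulForm_apply {Y X Z : Π x : M, TangentSpace I x} {x : M} (hY : MDiffAt (T% Y) x)
    (hX : MDiffAt (T% X) x) (hZ : MDiffAt (T% Z) x) :
    koszulForm g Y x hY (X x) (Z x) = koszul g Y X Z x :=
  TensorialAt.mkHom₂_apply _ _ hX hZ

theorem metric_injective (x : M) : Function.Injective (g.inner x) := by
  refine (injective_iff_map_eq_zero _).2 fun v hv ↦ ?_
  by_contra h
  have := g.pos x v h
  simp [hv] at this

/-- The musical isomorphism `v ↦ g(v, ·)` from vectors to covectors. -/
def flat (x : M) : TangentSpace I x ≃ₗ[ℝ] (TangentSpace I x →L[ℝ] ℝ) :=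
  haveI : FiniteDimensional ℝ (TangentSpace I x) := inferInstanceAs (FiniteDimensional ℝ E)
  haveI : T2Space (TangentSpace I x) := inferInstanceAs (T2Space E)
  LinearEquiv.ofBijective (g.inner x : TangentSpace I x →ₗ[ℝ] (TangentSpace I x →L[ℝ] ℝ))
    ⟨metric_injective g x, (LinearMap.injective_iff_surjective_of_finrank_eq_finrank (by
      rw [← (LinearMap.toContinuousLinearMap :
        (TangentSpace I x →ₗ[ℝ] ℝ) ≃ₗ[ℝ] (TangentSpace I x →L[ℝ] ℝ)).finrank_eq]
      exact Subspace.dual_finrank_eq.symm)).1 (metric_injective g x)⟩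

theorem metric_flat_symm (x : M) (φ : TangentSpace I x →L[ℝ] ℝ) (z : TangentSpace I x) :
    g.inner x ((flat g x).symm φ) z = φ z := by
  have : g.inner x ((flat g x).symm φ) = φ := (flat g x).apply_symm_apply φ
  rw [this]

open scoped Classical in
/-- `∇̂_v Y` at `x`: the vector with `2 g(∇̂_v Y, z)` equal to the Koszul expression. It is set to
zero where `Y` is not differentiable. -/
def leviCivitaFun (Y : Π x : M, TangentSpace I x) (x : M) :
    TangentSpace I x →L[ℝ] TangentSpace I x :=
  haveI : FiniteDimensional ℝ (TangentSpace I x) := inferInstanceAs (FiniteDimensional ℝ E)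
  haveI : T2Space (TangentSpace I x) := inferInstanceAs (T2Space E)
  if hY : MDiffAt (T% Y) x then
    LinearMap.toContinuousLinearMap ((1 / 2 : ℝ) •
      ((flat g x).symm.toLinearMap ∘ₗ
        (koszulForm g Y x hY : TangentSpace I x →ₗ[ℝ] (TangentSpace I x →L[ℝ] ℝ))))
  else 0

theorem metric_leviCivitaFun {X Y Z : Π x : M, TangentSpace I x} {x : M}
    (hX : MDiffAt (T% X) x) (hY : MDiffAt (T% Y) x) (hZ : MDiffAt (T% Z) x) :
    g.inner x (leviCivitaFun g Y x (X x)) (Z x) = koszul g Y X Z x / 2 := by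
  rw [leviCivitaFun, dif_pos hY]
  simp only [LinearMap.coe_toContinuousLinearMap', LinearMap.comp_apply,
    LinearEquiv.coe_coe, ContinuousLinearMap.coe_coe, map_smul, smul_apply,
    metric_flat_symm, smul_eq_mul]
  rw [koszulForm_apply g hY hX hZ]
  ring

/-- Tangent endomorphisms are determined by their metric pairings with differentiable fields. -/
theorem ext_of_metric {x : M} {A B : TangentSpace I x →L[ℝ] TangentSpace I x}
    (h : ∀ X Z : Π x : M, TangentSpace I x, MDiffAt (T% X) x → MDiffAt (T% Z) x →
      g.inner x (A (X x)) (Z x) = g.inner x (B (X x)) (Z x)) : A = B := by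
  ext1 v
  refine metric_injective g x (ContinuousLinearMap.ext fun z ↦ ?_)
  have := h (FiberBundle.extend E v) (FiberBundle.extend E z)
    (FiberBundle.mdifferentiableAt_extend ..) (FiberBundle.mdifferentiableAt_extend ..)
  simpa using this

/-- The Levi-Civita connection of a Riemannian metric, constructed from the Koszul formula.
`leviCivita g Y x v` is `∇̂_v Y` at `x`. -/
def leviCivita : CovariantDerivative I E (TangentSpace I : M → Type _) where
  toFun := leviCivitaFun g
  isCovariantDerivativeOnUniv :=
    { add := fun {Y Y' x} hY hY' _ ↦ by
        refine ext_of_metric g fun X Z hX hZ ↦ ?_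
        rw [metric_leviCivitaFun g hX (mdifferentiableAt_add_section hY hY') hZ,
          koszul_add g hY hY' hX hZ, add_apply, map_add, add_apply,
          metric_leviCivitaFun g hX hY hZ, metric_leviCivitaFun g hX hY' hZ]
        ring
      leibniz := fun {Y f x} hY hf _ ↦ by
        refine ext_of_metric g fun X Z hX hZ ↦ ?_
        rw [metric_leviCivitaFun g hX (hf.smul_section hY) hZ,
          koszul_smul g hf hY hX hZ, add_apply, map_add, add_apply, smul_apply, map_smul,
          smul_apply, metric_leviCivitaFun g hX hY hZ]
        simp
        ring }

/-- `leviCivita` is compatible with the metric. -/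
theorem leviCivita_metric {X Y Z : Π x : M, TangentSpace I x} {x : M}
    (hX : MDiffAt (T% X) x) (hY : MDiffAt (T% Y) x) (hZ : MDiffAt (T% Z) x) :
    mvfderiv I (fun y ↦ g.inner y (Y y) (Z y)) x (X x)
      = g.inner x (leviCivita g Y x (X x)) (Z x) + g.inner x (Y x) (leviCivita g Z x (X x)) := by
  change _ = g.inner x (leviCivitaFun g Y x (X x)) (Z x)
    + g.inner x (Y x) (leviCivitaFun g Z x (X x))
  rw [g.symm x (Y x), metric_leviCivitaFun g hX hY hZ, metric_leviCivitaFun g hX hZ hY]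
  simp only [koszul]
  rw [metric_comm g Z Y, metric_comm g X Z, metric_comm g X Y,
    VectorField.mlieBracket_swap_apply (V := Z) (W := Y)]
  simp only [map_neg, neg_apply]
  ring

/-- `leviCivita` is torsion-free. -/
theorem leviCivita_torsion_free {X Y : Π x : M, TangentSpace I x} {x : M}
    (hX : MDiffAt (T% X) x) (hY : MDiffAt (T% Y) x) :
    leviCivita g Y x (X x) - leviCivita g X x (Y x) = VectorField.mlieBracket I X Y x := by
  refine metric_injective g x (ContinuousLinearMap.ext fun z ↦ ?_)
  have hZ : MDiffAt (T% (FiberBundle.extend E z : Π x : M, TangentSpace I x)) x :=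
    FiberBundle.mdifferentiableAt_extend ..
  have h1 := metric_leviCivitaFun g hX hY hZ
  have h2 := metric_leviCivitaFun g hY hX hZ
  simp only [FiberBundle.extend_apply_self] at h1 h2
  change g.inner x (leviCivitaFun g Y x (X x) - leviCivitaFun g X x (Y x)) z = _
  rw [map_sub, sub_apply, h1, h2]
  simp only [koszul, FiberBundle.extend_apply_self]
  rw [metric_comm g Y X, VectorField.mlieBracket_swap_apply (V := Y) (W := X)]
  simp only [map_neg, neg_apply]
  ring

end LeviCivita
section Statistical

variable {E : Type*} [NormedAddCommGroup E] [NormedSpace ℝ E] [FiniteDimensional ℝ E]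
  {H : Type*} [TopologicalSpace H] (I : ModelWithCorners ℝ E H)
  (M : Type*) [TopologicalSpace M] [ChartedSpace H M] [IsManifold I ∞ M]

/-- A statistical structure `(g, K)` on the smooth manifold `M`: a smooth Riemannian metric `g`
and a smooth `(1,2)`-tensor field `K` such that `g(K(X, Y), Z)` is symmetric in `X, Y, Z`. -/
structure StatisticalStructure where
  /-- The Riemannian metric. -/
  g : ContMDiffRiemannianMetric I ∞ E (fun x : M ↦ TangentSpace I x)
  /-- The `(1,2)`-tensor; `K x u v` is `K(u, v) = K_u v`. -/
  K (x : M) : TangentSpace I x →L[ℝ] TangentSpace I x →L[ℝ] TangentSpace I x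
  contMDiff_K : ContMDiff I (I.prod 𝓘(ℝ, E →L[ℝ] E →L[ℝ] E)) ∞
    (fun x ↦ TotalSpace.mk' (E →L[ℝ] E →L[ℝ] E)
      (E := fun x : M ↦ TangentSpace I x →L[ℝ] TangentSpace I x →L[ℝ] TangentSpace I x) x (K x))
  symm_left (x : M) (u v w : TangentSpace I x) : g.inner x (K x u v) w = g.inner x (K x v u) w
  symm_right (x : M) (u v w : TangentSpace I x) : g.inner x (K x u v) w = g.inner x (K x u w) v

namespace StatisticalStructure

variable {I M} (S : StatisticalStructure I M)

/-- The cubic form `C(u, v, w) = g(K(u, v), w)`. -/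
def C (x : M) (u v w : TangentSpace I x) : ℝ := S.g.inner x (S.K x u v) w

/-- `K` is non-degenerate: `u ↦ K_u` is injective on every tangent space. -/
def IsNondegenerate : Prop := ∀ x : M, Function.Injective (S.K x)

/-- The tensor `[K, K](u, v) w = K_u K_v w - K_v K_u w`. -/
def bracketKK (x : M) (u v w : TangentSpace I x) : TangentSpace I x :=
  S.K x u (S.K x v w) - S.K x v (S.K x u w)

/-- The covariant derivative of `C` along the Levi-Civita connection, evaluated on vector fields:
`(∇̂_W C)(X, Y, Z) = W C(X, Y, Z) - C(∇̂_W X, Y, Z) - C(X, ∇̂_W Y, Z) - C(X, Y, ∇̂_W Z)`. -/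
def nablaC (W X Y Z : Π x : M, TangentSpace I x) (x : M) : ℝ :=
  mvfderiv I (fun y ↦ S.C y (X y) (Y y) (Z y)) x (W x)
    - S.C x (leviCivita S.g X x (W x)) (Y x) (Z x)
    - S.C x (X x) (leviCivita S.g Y x (W x)) (Z x)
    - S.C x (X x) (Y x) (leviCivita S.g Z x (W x))

/-- `∇̂C = 0` as a `(0,4)`-tensor field. -/
def NablaCEqZero : Prop :=
  ∀ (x : M) (W X Y Z : Π x : M, TangentSpace I x), MDiffAt (T% W) x → MDiffAt (T% X) x →
    MDiffAt (T% Y) x → MDiffAt (T% Z) x → S.nablaC W X Y Z x = 0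

/-- `∇̂C` is a totally symmetric `(0,4)`-tensor field: it is invariant under the three adjacent
transpositions of its arguments, which generate all permutations. -/
def NablaCSymmetric : Prop :=
  ∀ (x : M) (W X Y Z : Π x : M, TangentSpace I x), MDiffAt (T% W) x → MDiffAt (T% X) x →
    MDiffAt (T% Y) x → MDiffAt (T% Z) x →
      S.nablaC W X Y Z x = S.nablaC X W Y Z x ∧
      S.nablaC W X Y Z x = S.nablaC W Y X Z x ∧
      S.nablaC W X Y Z x = S.nablaC W X Z Y x

/-- A basis of the tangent space at `x`. -/
def tangentBasis (x : M) :
    Module.Basis (Fin (Module.finrank ℝ E)) ℝ (TangentSpace I x) :=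
  (Module.finBasis ℝ E : Module.Basis (Fin (Module.finrank ℝ E)) ℝ E)

/-- The Gram matrix `g_{ij}` of the metric in the basis `tangentBasis x`. -/
def gram (x : M) : Matrix (Fin (Module.finrank ℝ E)) (Fin (Module.finrank ℝ E)) ℝ :=
  Matrix.of fun i j ↦ S.g.inner x (tangentBasis x i) (tangentBasis x j)

/-- The vector field `E = tr_g K`, that is `E = g^{ij} K(b_i, b_j)` for a basis `b` of the tangent
space, with `(g^{ij})` the inverse of the Gram matrix (the result does not depend on `b`). -/
def traceField (x : M) : TangentSpace I x :=
  ∑ i, ∑ j, (S.gram x)⁻¹ i j • S.K x (tangentBasis x i) (tangentBasis x j)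

/-- `u` is a canonical frame on `U`: smooth vector fields on `U` that form a basis of the tangent
space at each point of `U` and satisfy `K(u_i, u_i) = u_i` and `K(u_i, u_j) = 0` for `i ≠ j`. -/
structure IsCanonicalFrameOn {ι : Type*} (u : ι → Π x : M, TangentSpace I x) (U : Set M) :
    Prop where
  isLocalFrameOn : IsLocalFrameOn I E ∞ u U
  idem (i : ι) : ∀ x ∈ U, S.K x (u i x) (u i x) = u i x
  orth (i j : ι) : i ≠ j → ∀ x ∈ U, S.K x (u i x) (u j x) = 0

end StatisticalStructure

end Statistical

end StatGeom

end

namespace StatGeom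

section Algebra

variable {V : Type*} [AddCommGroup V] [Module ℝ V]

theorem linearIndependent_of_orthogonal_idempotents {ι : Type*} (K : V →ₗ[ℝ] V →ₗ[ℝ] V)
    {u : ι → V} (h0 : ∀ i, u i ≠ 0) (h1 : ∀ i, K (u i) (u i) = u i)
    (h2 : ∀ i j, i ≠ j → K (u i) (u j) = 0) : LinearIndependent ℝ u := by
  classical
  rw [linearIndependent_iff']
  intro s c hc j hj
  have h := congr_arg (K (u j)) hc
  rw [map_sum, map_zero, Finset.sum_eq_single j] at h
  · rw [map_smul, h1] at h
    exact (smul_eq_zero.1 h).resolve_right (h0 j)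
  · intro i _ hij
    rw [map_smul, h2 j i hij.symm, smul_zero]
  · exact fun h' ↦ absurd hj h'

open Module.End in
/-- A commuting family of self-adjoint multiplications without kernel has a basis of orthogonal
idempotents. -/
theorem exists_basis_orthogonal_idempotents [FiniteDimensional ℝ V]
    (core : InnerProductSpace.Core ℝ V) (K : V →ₗ[ℝ] V →ₗ[ℝ] V)
    (hcomm : ∀ u v, K u v = K v u)
    (hsymm : ∀ u v w, core.inner (K u v) w = core.inner v (K u w))
    (hKK : ∀ u v w, K u (K v w) = K v (K u w)) (hinj : Function.Injective K) :
    ∃ u : Module.Basis (Fin (Module.finrank ℝ V)) ℝ V,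
      (∀ i, K (u i) (u i) = u i) ∧ ∀ i j, i ≠ j → K (u i) (u j) = 0 := by
  let _ : NormedAddCommGroup V := core.toNormedAddCommGroup
  let _ : InnerProductSpace ℝ V := .ofCore core.toCore
  have hsymm' : ∀ u, (K u).IsSymmetric := fun u v w ↦ hsymm u v w
  have hcom : Pairwise (Function.onFun Commute fun u ↦ K u) := fun u v _ ↦
    LinearMap.ext fun w ↦ hKK u v w
  have htop := LinearMap.IsSymmetric.iSup_iInf_eq_top_of_commute hsymm' hcom
  have hsq : ∀ v, K v v = 0 → v = 0 := by
    intro v hv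
    refine hinj ?_
    rw [map_zero]
    ext w
    have h : K v (K v w) = 0 := by rw [hcomm v w, hKK, hv, map_zero]
    have h' : inner ℝ (K v w) (K v w) = 0 := by
      rw [hsymm' v, h, inner_zero_right]
    simpa using h'
  set W : (V → ℝ) → Submodule ℝ V := fun χ ↦ ⨅ u, eigenspace (K u) (χ u) with hW
  have hmem : ∀ {χ v}, v ∈ W χ ↔ ∀ u, K u v = χ u • v := by
    intro χ v
    simp [hW, Submodule.mem_iInf]
  let B : Set V := {v | v ≠ 0 ∧ K v v = v ∧ ∃ χ, v ∈ W χ}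
  have horth : ∀ a b : B, a ≠ b → K (a : V) (b : V) = 0 := by
    rintro ⟨a, ha0, ha, χ, hχ⟩ ⟨b, hb0, hb, ψ, hψ⟩ hab
    by_contra hne
    have e1 := hmem.1 hψ a
    have e2 := hmem.1 hχ b
    simp only at hne
    rw [hcomm b a, e1] at e2
    rw [e1] at hne
    have hψ0 : ψ a ≠ 0 := fun h ↦ hne (by rw [h, zero_smul])
    have hb' : b = ((ψ a)⁻¹ * χ b) • a := by
      rw [mul_smul, ← e2, smul_smul, inv_mul_cancel₀ hψ0, one_smul]
    set c := (ψ a)⁻¹ * χ b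
    have hc : c ≠ 0 := fun h ↦ hb0 (by rw [hb', h, zero_smul])
    rw [hb'] at hb
    simp only [map_smul, LinearMap.smul_apply, ha, smul_smul] at hb
    have h3 := smul_left_injective ℝ ha0 hb
    have h4 : c = 1 := by
      have : c * (c - 1) = 0 := by linear_combination h3
      rcases mul_eq_zero.1 this with h | h
      · exact absurd h hc
      · linarith
    exact hab (Subtype.ext (by simp [hb', h4]))
  have hli : LinearIndependent ℝ (Subtype.val : B → V) :=
    linearIndependent_of_orthogonal_idempotents K (fun a ↦ a.2.1) (fun a ↦ a.2.2.1) horth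
  have hspan : ⊤ ≤ Submodule.span ℝ (Set.range (Subtype.val : B → V)) := by
    rw [← htop, iSup_le_iff, Subtype.range_coe]
    intro χ v hv
    change v ∈ W χ at hv
    by_cases hv0 : v = 0
    · rw [hv0]; exact zero_mem _
    have e1 := hmem.1 hv v
    have hχ : χ v ≠ 0 := fun h ↦ hv0 (hsq v (by rw [e1, h, zero_smul]))
    have : (χ v)⁻¹ • v ∈ B := by
      refine ⟨smul_ne_zero (inv_ne_zero hχ) hv0, ?_, χ, (W χ).smul_mem _ hv⟩
      simp only [map_smul, LinearMap.smul_apply, e1, smul_smul]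
      rw [inv_mul_cancel₀ hχ, mul_one]
    have h := Submodule.smul_mem _ (χ v) (Submodule.subset_span (R := ℝ) this)
    rwa [smul_smul, mul_inv_cancel₀ hχ, one_smul] at h
  let b := Module.Basis.mk hli hspan
  have : Fintype B := FiniteDimensional.fintypeBasisIndex b
  let σ := Fintype.equivFinOfCardEq (Module.finrank_eq_card_basis b).symm
  refine ⟨b.reindex σ, fun i ↦ ?_, fun i j hij ↦ ?_⟩
  · simpa [b] using (σ.symm i).2.2.1
  · simpa [b] using horth _ _ (σ.symm.injective.ne hij)

end Algebra

section Smooth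

variable {D F : Type*} [NormedAddCommGroup D] [NormedSpace ℝ D]
  [NormedAddCommGroup F] [NormedSpace ℝ F]

/-- The defect `k_y(u, u) - u` of idempotency. -/
noncomputable def idempotentDefect (k : D → F →L[ℝ] F →L[ℝ] F) (z : D × F) : F := k z.1 z.2 z.2 - z.2

theorem contDiffAt_idempotentDefect {k : D → F →L[ℝ] F →L[ℝ] F} {z : D × F}
    (hk : ContDiffAt ℝ ∞ k z.1) : ContDiffAt ℝ ∞ (idempotentDefect k) z := by
  have h1 : ContDiffAt ℝ ∞ (fun z : D × F ↦ k z.1) z := hk.comp z contDiffAt_fst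
  exact ((h1.clm_apply contDiffAt_snd).clm_apply contDiffAt_snd).sub contDiffAt_snd

theorem isInvertible_fderiv_idempotentDefect {k : D → F →L[ℝ] F →L[ℝ] F} {z : D × F}
    (hk : ContDiffAt ℝ ∞ k z.1) (hcomm : ∀ a b, k z.1 a b = k z.1 b a)
    (hKK : ∀ a b c, k z.1 a (k z.1 b c) = k z.1 b (k z.1 a c))
    (hz : k z.1 z.2 z.2 = z.2) :
    (fderiv ℝ (idempotentDefect k) z ∘L .inr ℝ D F).IsInvertible := by
  obtain ⟨y, u⟩ := z
  simp only at hk hcomm hKK hz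
  have hd : HasFDerivAt (idempotentDefect k) (fderiv ℝ (idempotentDefect k) (y, u)) (y, u) :=
    ((contDiffAt_idempotentDefect (z := (y, u)) hk).differentiableAt (by simp)).hasFDerivAt
  have h1 : HasFDerivAt (fun v ↦ idempotentDefect k (y, v))
      (fderiv ℝ (idempotentDefect k) (y, u) ∘L .inr ℝ D F) u :=
    hd.comp u (hasFDerivAt_prodMk_right y u)
  have h2 : HasFDerivAt (fun v ↦ idempotentDefect k (y, v))
      ((2 : ℝ) • k y u - .id ℝ F) u := by
    have h := (((k y).hasFDerivAt (x := u)).clm_apply (hasFDerivAt_id u)).sub (hasFDerivAt_id u)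
    refine h.congr_fderiv ?_
    ext v
    simp [two_smul, hcomm v u]
  rw [h1.unique h2]
  have hproj : ∀ v, k y u (k y u v) = k y u v := by
    intro v
    rw [hcomm u v, hKK u v u, hz]
  have hinv : ∀ v, ((2 : ℝ) • k y u - .id ℝ F) (((2 : ℝ) • k y u - .id ℝ F) v) = v := by
    intro v
    simp only [sub_apply, smul_apply, ContinuousLinearMap.id_apply, map_sub, map_smul, hproj]
    module
  exact ⟨ContinuousLinearEquiv.equivOfInverse _ _ hinv hinv, rfl⟩

variable [CompleteSpace D] [CompleteSpace F]

/-- An idempotent of a smooth family of commutative associative multiplications extends to a smooth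
family of idempotents. -/
theorem exists_contDiffOn_idempotent {k : D → F →L[ℝ] F →L[ℝ] F} {Ω : Set D} (hΩ : IsOpen Ω)
    (hk : ContDiffOn ℝ ∞ k Ω) (hcomm : ∀ y ∈ Ω, ∀ a b, k y a b = k y b a)
    (hKK : ∀ y ∈ Ω, ∀ a b c, k y a (k y b c) = k y b (k y a c))
    {y₀ : D} (hy₀ : y₀ ∈ Ω) {u : F} (hu : k y₀ u u = u) :
    ∃ w : D → F, w y₀ = u ∧ ∀ᶠ y in 𝓝 y₀, ContDiffAt ℝ ∞ w y ∧ k y (w y) (w y) = w y := by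
  have hk' : ∀ y ∈ Ω, ContDiffAt ℝ ∞ k y := fun y hy ↦ hk.contDiffAt (hΩ.mem_nhds hy)
  have hf : ∀ z : D × F, z.1 ∈ Ω → ContDiffAt ℝ ∞ (idempotentDefect k) z := fun z hz ↦
    contDiffAt_idempotentDefect (hk' _ hz)
  have hi : ∀ z : D × F, z.1 ∈ Ω → k z.1 z.2 z.2 = z.2 →
      (fderiv ℝ (idempotentDefect k) z ∘L .inr ℝ D F).IsInvertible := fun z hz h ↦
    isInvertible_fderiv_idempotentDefect (hk' _ hz) (hcomm _ hz) (hKK _ hz) h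
  have hn : (∞ : WithTop ℕ∞) ≠ 0 := by simp
  let w := (hf (y₀, u) hy₀).implicitFunction hn (hi (y₀, u) hy₀ hu)
  have hw₀ : w y₀ = u := (hf (y₀, u) hy₀).implicitFunction_apply_self hn _
  have hwsm : ContDiffAt ℝ ∞ w y₀ := (hf (y₀, u) hy₀).contDiffAt_implicitFunction hn _
  have hzero : idempotentDefect k (y₀, u) = 0 := by simp [idempotentDefect, hu]
  have hweq : ∀ᶠ y in 𝓝 y₀, idempotentDefect k (y, w y) = 0 := by
    have := (hf (y₀, u) hy₀).eventually_apply_implicitFunction hn (hi (y₀, u) hy₀ hu)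
    rw [hzero] at this
    exact this
  have hcont : ∀ᶠ y in 𝓝 y₀, ContinuousAt w y := by
    have h1 : ContDiffAt ℝ 1 w y₀ := hwsm.of_le (by norm_cast)
    filter_upwards [h1.eventually (by simp)] with y hy using hy.continuousAt
  refine ⟨w, hw₀, ?_⟩
  filter_upwards [hweq.eventually_nhds, hcont, hΩ.mem_nhds hy₀] with y hy hc hyΩ
  have hid : k y (w y) (w y) = w y := sub_eq_zero.1 hy.self_of_nhds
  refine ⟨?_, hid⟩
  have hev := (hf (y, w y) hyΩ).eventually_apply_eq_iff_implicitFunction hn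
    (hi (y, w y) hyΩ hid)
  have hsm := (hf (y, w y) hyΩ).contDiffAt_implicitFunction hn (hi (y, w y) hyΩ hid)
  refine hsm.congr_of_eventuallyEq ?_
  have ht : Filter.Tendsto (fun x ↦ (x, w x)) (𝓝 y) (𝓝 (y, w y)) :=
    (continuousAt_id.prodMk hc)
  filter_upwards [ht.eventually hev, hy] with x hx hx'
  exact (hx.1 (hx'.trans hy.self_of_nhds.symm)).symm

set_option synthInstance.maxHeartbeats 200000 in
theorem exists_contDiffOn_orthogonal_idempotents {ι : Type*} [Finite ι]
    {k : D → F →L[ℝ] F →L[ℝ] F} {Ω : Set D} (hΩ : IsOpen Ω)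
    (hk : ContDiffOn ℝ ∞ k Ω) (hcomm : ∀ y ∈ Ω, ∀ a b, k y a b = k y b a)
    (hKK : ∀ y ∈ Ω, ∀ a b c, k y a (k y b c) = k y b (k y a c))
    {y₀ : D} (hy₀ : y₀ ∈ Ω) {u : ι → F} (h0 : ∀ i, u i ≠ 0) (h1 : ∀ i, k y₀ (u i) (u i) = u i)
    (h2 : ∀ i j, i ≠ j → k y₀ (u i) (u j) = 0) :
    ∃ w : ι → D → F, ∀ᶠ y in 𝓝 y₀, ∀ i, ContDiffAt ℝ ∞ (w i) y ∧ w i y ≠ 0 ∧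
      k y (w i y) (w i y) = w i y ∧ ∀ j, i ≠ j → k y (w i y) (w j y) = 0 := by
  choose w hw0 hw using fun i ↦ exists_contDiffOn_idempotent hΩ hk hcomm hKK hy₀ (h1 i)
  have hkc : ContinuousAt k y₀ := (hk.contDiffAt (hΩ.mem_nhds hy₀)).continuousAt
  have hwc : ∀ i, ContinuousAt (w i) y₀ := fun i ↦ (hw i).self_of_nhds.1.continuousAt
  refine ⟨w, Filter.eventually_all.2 fun i ↦ ?_⟩
  have hne : ∀ᶠ y in 𝓝 y₀, w i y ≠ 0 := (hwc i).eventually_ne (by rw [hw0]; exact h0 i)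
  have horth : ∀ᶠ y in 𝓝 y₀, ∀ j, i ≠ j → k y (w i y) (w j y) = 0 := by
    refine Filter.eventually_all.2 fun j ↦ ?_
    by_cases hij : i = j
    · exact Filter.Eventually.of_forall fun y h ↦ absurd hij h
    have hkn : ContinuousAt (fun y ↦ ‖k y‖) y₀ :=
      Filter.Tendsto.comp (g := norm) (f := k) (continuous_norm.tendsto (k y₀)) hkc
    have hpn : ContinuousAt (fun y ↦ ‖k y (w i y) (w j y)‖) y₀ :=
      ((hkc.clm_apply (hwc i)).clm_apply (hwc j)).norm
    have hpc : ContinuousAt (fun y ↦ ‖k y‖ * ‖k y (w i y) (w j y)‖) y₀ := hkn.mul hpn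
    have hlt : ∀ᶠ y in 𝓝 y₀, ‖k y‖ * ‖k y (w i y) (w j y)‖ < 1 := by
      refine hpc.eventually_lt continuousAt_const ?_
      rw [hw0, hw0, h2 i j hij, norm_zero, mul_zero]
      exact one_pos
    filter_upwards [hlt, hw i, hw j, hΩ.mem_nhds hy₀] with y hy hi hj hyΩ _
    set a := w i y
    set b := w j y
    set p := k y a b with hp
    have hpp : k y p p = p := by
      have e1 : k y p p = k y a (k y p b) := by
        conv_lhs => rw [hp]
        rw [← hp, hKK y hyΩ a p b, ← hp]
      have e2 : k y p b = p := by
        rw [hcomm y hyΩ p b, hp, hKK y hyΩ b a b, hj.2]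
      rw [e1, e2, hp, hcomm y hyΩ a b, hKK y hyΩ a b a, hi.2]
    by_contra hp0
    have hn : 0 < ‖p‖ := norm_pos_iff.2 hp0
    have hle : ‖p‖ ≤ ‖k y‖ * ‖p‖ * ‖p‖ := by
      conv_lhs => rw [← hpp]
      exact (k y).le_opNorm₂ p p
    nlinarith
  filter_upwards [hw i, hne, horth] with y h1 h2 h3
  exact ⟨h1.1, h2, h1.2, h3⟩

end Smooth

section

variable {E : Type*} [NormedAddCommGroup E] [NormedSpace ℝ E]
  {H : Type*} [TopologicalSpace H] {I : ModelWithCorners ℝ E H} [I.Boundaryless]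
  {M : Type*} [TopologicalSpace M] [ChartedSpace H M] [IsManifold I ∞ M]

theorem eventually_eq_of_mvfderiv_eq_zero {f : M → ℝ} {U : Set M} (hU : IsOpen U)
    (hf : ∀ x ∈ U, MDiffAt f x) (hf' : ∀ x ∈ U, mvfderiv I f x = 0) {p : M} (hp : p ∈ U) :
    ∀ᶠ x in 𝓝 p, f x = f p := by
  set φ := extChartAt I p
  let T : Set E := φ.target ∩ φ.symm ⁻¹' U
  have hT : IsOpen T := by
    exact (continuousOn_extChartAt_symm p).isOpen_inter_preimage (isOpen_extChartAt_target p) hU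
  have hpT : φ p ∈ T := ⟨mem_extChartAt_target p, by
    simpa only [Set.mem_preimage, φ, extChartAt_to_inv] using hp⟩
  have hd : ∀ y ∈ T, HasFDerivAt (f ∘ φ.symm) (0 : E →L[ℝ] ℝ) y := by
    intro y hy
    have h1 : MDifferentiableAt 𝓘(ℝ, E) I φ.symm y :=
      ((contMDiffOn_extChartAt_symm (n := ∞) p).contMDiffAt
        ((isOpen_extChartAt_target p).mem_nhds hy.1)).mdifferentiableAt (by simp)
    have h2 : MDifferentiableAt I 𝓘(ℝ, ℝ) f (φ.symm y) := hf _ hy.2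
    have h3 := (h2.comp y h1).hasMFDerivAt
    have h4 : mfderiv I 𝓘(ℝ, ℝ) f (φ.symm y) = 0 := by
      have h := hf' _ hy.2
      ext v
      exact congrArg (fun A ↦ A v) h
    rw [mfderiv_comp y h2 h1, h4] at h3
    have h5 := h3.hasFDerivAt
    refine h5.congr_fderiv ?_
    ext v
    rfl
  obtain ⟨r, hr, hball⟩ := Metric.isOpen_iff.1 hT _ hpT
  have hconst : ∀ y ∈ Metric.ball (φ p) r, f (φ.symm y) = f p := by
    intro y hy
    have h := (convex_ball (φ p) r).is_const_of_fderivWithin_eq_zero (𝕜 := ℝ)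
      (f := f ∘ φ.symm)
      (fun z hz ↦ (hd z (hball hz)).differentiableAt.differentiableWithinAt)
      (fun z hz ↦ by
        rw [fderivWithin_of_isOpen Metric.isOpen_ball hz]
        exact (hd z (hball hz)).fderiv) hy (Metric.mem_ball_self hr)
    simpa [φ] using h
  filter_upwards [extChartAt_source_mem_nhds (I := I) p,
    (continuousAt_extChartAt (I := I) p).preimage_mem_nhds (Metric.ball_mem_nhds _ hr)] with x h1 h2
  have := hconst _ h2
  rwa [show φ.symm (extChartAt I p x) = x from φ.left_inv h1] at this

theorem exists_const_of_mvfderiv_eq_zero {f : M → ℝ} {U : Set M} (hU : IsOpen U)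
    (hU' : IsPreconnected U) (hf : ∀ x ∈ U, MDiffAt f x) (hf' : ∀ x ∈ U, mvfderiv I f x = 0) :
    ∃ c, ∀ x ∈ U, f x = c := by
  obtain rfl | ⟨p, hp⟩ := U.eq_empty_or_nonempty
  · exact ⟨0, by simp⟩
  refine ⟨f p, fun x hx ↦ ?_⟩
  have hopen : ∀ s : Set ℝ, IsOpen (U ∩ f ⁻¹' s) := by
    intro s
    rw [isOpen_iff_mem_nhds]
    rintro y ⟨hy, hys⟩
    filter_upwards [hU.mem_nhds hy, eventually_eq_of_mvfderiv_eq_zero hU hf hf' hy] with z h1 h2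
    exact ⟨h1, by rwa [Set.mem_preimage, h2]⟩
  have hcover : U ⊆ U ∩ f ⁻¹' {f p} ∪ U ∩ f ⁻¹' {f p}ᶜ := fun y hy ↦
    (em (f y = f p)).imp (fun h ↦ ⟨hy, h⟩) (fun h ↦ ⟨hy, h⟩)
  by_contra hne
  obtain ⟨z, _, hz, hz'⟩ := hU' _ _ (hopen {f p}) (hopen {f p}ᶜ)
    hcover ⟨p, hp, hp, rfl⟩ ⟨x, hx, hx, hne⟩
  exact hz'.2 hz.2

end

namespace StatisticalStructure

variable {E : Type*} [NormedAddCommGroup E] [NormedSpace ℝ E]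
  {H : Type*} [TopologicalSpace H] {I : ModelWithCorners ℝ E H}
  {M : Type*} [TopologicalSpace M] [ChartedSpace H M] [IsManifold I ∞ M]
  (S : StatisticalStructure I M)

/-- The tensor `K` read in the trivialization of the tangent bundle at `p`. -/
noncomputable def coordK (p x : M) : E →L[ℝ] E →L[ℝ] E :=
  (trivializationAt (E →L[ℝ] E →L[ℝ] E)
    (fun x : M ↦ TangentSpace I x →L[ℝ] TangentSpace I x →L[ℝ] TangentSpace I x) p
    ⟨x, S.K x⟩).2

theorem coordK_apply (p : M) {x : M}
    (hx : x ∈ (trivializationAt E (TangentSpace I : M → Type _) p).baseSet) (a b : E) :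
    S.coordK p x a b = (trivializationAt E (TangentSpace I : M → Type _) p).continuousLinearMapAt ℝ x
      (S.K x ((trivializationAt E (TangentSpace I : M → Type _) p).symmL ℝ x a)
        ((trivializationAt E (TangentSpace I : M → Type _) p).symmL ℝ x b)) := by
  simp only [coordK, hom_trivializationAt_apply]
  rw [ContinuousLinearMap.inCoordinates_eq hx (by simpa using hx)]
  simp only [ContinuousLinearMap.comp_apply, ContinuousLinearEquiv.coe_coe,
    Trivialization.coe_continuousLinearEquivAt_eq, Trivialization.symm_continuousLinearEquivAt_eq]
  have h := Trivialization.continuousLinearMapAt_apply_of_mem (R := ℝ)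
    (trivializationAt (E →L[ℝ] E) (fun x : M ↦ TangentSpace I x →L[ℝ] TangentSpace I x) p)
    (b := x) (by simpa using hx)
    (S.K x ((trivializationAt E (TangentSpace I : M → Type _) p).symmL ℝ x a))
  exact congrArg (fun A : E →L[ℝ] E ↦ A b) h

theorem contMDiffOn_coordK (p : M) :
    ContMDiffOn I 𝓘(ℝ, E →L[ℝ] E →L[ℝ] E) ∞ (S.coordK p)
      (trivializationAt E (TangentSpace I : M → Type _) p).baseSet := by
  have h := (Trivialization.contMDiffOn_section_baseSet_iff (n := ∞) (IB := I)
    (s := S.K) (trivializationAt (E →L[ℝ] E →L[ℝ] E)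
    (fun x : M ↦ TangentSpace I x →L[ℝ] TangentSpace I x →L[ℝ] TangentSpace I x) p)).1
    S.contMDiff_K.contMDiffOn
  refine h.mono fun x hx ↦ ?_
  simpa using hx

variable [FiniteDimensional ℝ E]

theorem K_comm (x : M) (u v : TangentSpace I x) : S.K x u v = S.K x v u :=
  metric_injective S.g x (ContinuousLinearMap.ext fun w ↦ S.symm_left x u v w)

/-- Every point has a neighbourhood with a canonical frame. -/
theorem exists_isCanonicalFrameOn [I.Boundaryless] (hK : S.IsNondegenerate)
    (hKK : ∀ (x : M) (v w z : TangentSpace I x), S.bracketKK x v w z = 0) (p : M) :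
    ∃ U : Set M, IsOpen U ∧ p ∈ U ∧
      ∃ u : Fin (Module.finrank ℝ E) → Π x : M, TangentSpace I x, S.IsCanonicalFrameOn u U := by
  have hKK' : ∀ (x : M) (v w z : TangentSpace I x),
      S.K x v (S.K x w z) = S.K x w (S.K x v z) := fun x v w z ↦ sub_eq_zero.1 (hKK x v w z)
  have hfd : ∀ x : M, FiniteDimensional ℝ (TangentSpace I x) :=
    fun _ ↦ inferInstanceAs (FiniteDimensional ℝ E)
  let Kp : TangentSpace I p →ₗ[ℝ] TangentSpace I p →ₗ[ℝ] TangentSpace I p :=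
    LinearMap.mk₂ ℝ (fun u v ↦ S.K p u v) (by simp) (by simp) (by simp) (by simp)
  have hKp : ∀ u v, Kp u v = S.K p u v := fun _ _ ↦ rfl
  obtain ⟨b, hb1, hb2⟩ := exists_basis_orthogonal_idempotents
    (S.g.toRiemannianMetric.toCore p) Kp (fun u v ↦ S.K_comm p u v)
    (fun u v w ↦ by
      change S.g.inner p (S.K p u v) w = S.g.inner p v (S.K p u w)
      rw [S.symm_right, S.g.symm])
    (fun u v w ↦ hKK' p u v w)
    (fun u v h ↦ hK p (ContinuousLinearMap.ext fun w ↦ congrArg (fun A ↦ A w) h))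
  set e := trivializationAt E (TangentSpace I : M → Type _) p with he
  set φ := extChartAt I p with hφ
  have hbase : e.baseSet = φ.source := by
    rw [hφ, extChartAt_source]; rfl
  have hsymm : ∀ x ∈ e.baseSet, ∀ v : TangentSpace I x,
      e.symmL ℝ x (e.continuousLinearMapAt ℝ x v) = v :=
    fun x hx v ↦ e.symmL_continuousLinearMapAt hx v
  have hsymm' : ∀ x ∈ e.baseSet, ∀ a : E,
      e.continuousLinearMapAt ℝ x (e.symmL ℝ x a) = a :=
    fun x hx v ↦ e.continuousLinearMapAt_symmL hx v
  have hpb : p ∈ e.baseSet := FiberBundle.mem_baseSet_trivializationAt' p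
  have hmaps : ∀ y ∈ φ.target, φ.symm y ∈ e.baseSet := fun y hy ↦ by
    rw [hbase]; exact φ.map_target hy
  have hpt : φ p ∈ φ.target := mem_extChartAt_target p
  have hpinv : φ.symm (φ p) = p := φ.left_inv (mem_extChartAt_source p)
  have hk : ContDiffOn ℝ ∞ (fun y ↦ S.coordK p (φ.symm y)) φ.target := by
    rw [← contMDiffOn_iff_contDiffOn]
    exact (S.contMDiffOn_coordK p).comp (contMDiffOn_extChartAt_symm p) hmaps
  obtain ⟨w, hw⟩ := exists_contDiffOn_orthogonal_idempotents (isOpen_extChartAt_target p) hk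
    (fun y hy a b ↦ by
      rw [S.coordK_apply p (hmaps y hy), S.coordK_apply p (hmaps y hy), S.K_comm])
    (fun y hy a b c ↦ by
      simp only [S.coordK_apply p (hmaps y hy)]
      rw [hsymm _ (hmaps y hy), hsymm _ (hmaps y hy), hKK'])
    hpt (u := fun i ↦ e.continuousLinearMapAt ℝ p (b i))
    (fun i h ↦ b.ne_zero i (by rw [← hsymm p hpb (b i), h, map_zero]))
    (fun i ↦ by
      rw [hpinv, S.coordK_apply p hpb, hsymm p hpb, ← hKp, hb1])
    (fun i j hij ↦ by
      rw [hpinv, S.coordK_apply p hpb, hsymm p hpb, hsymm p hpb, ← hKp, hb2 i j hij, map_zero])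
  have hev := (continuousAt_extChartAt (I := I) p).eventually hw
  obtain ⟨U, hUsub, hUo, hpU⟩ := mem_nhds_iff.1
    (Filter.inter_mem (extChartAt_source_mem_nhds (I := I) p) hev)
  have hUb : ∀ x ∈ U, x ∈ e.baseSet := fun x hx ↦ by rw [hbase]; exact (hUsub hx).1
  have hUw := fun x (hx : x ∈ U) ↦ (hUsub hx).2
  have hinv : ∀ x ∈ U, φ.symm (φ x) = x := fun x hx ↦ φ.left_inv (hUsub hx).1
  let u : Fin (Module.finrank ℝ E) → Π x : M, TangentSpace I x :=
    fun i x ↦ e.symmL ℝ x (w i (φ x))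
  have hKu : ∀ x ∈ U, ∀ i j, S.K x (u i x) (u j x) =
      e.symmL ℝ x (S.coordK p (φ.symm (φ x)) (w i (φ x)) (w j (φ x))) := fun x hx i j ↦ by
    rw [hinv x hx, S.coordK_apply p (hUb x hx), hsymm x (hUb x hx)]
  have hidem : ∀ i, ∀ x ∈ U, S.K x (u i x) (u i x) = u i x := fun i x hx ↦ by
    rw [hKu x hx, (hUw x hx i).2.2.1]
  have horth : ∀ i j, i ≠ j → ∀ x ∈ U, S.K x (u i x) (u j x) = 0 := fun i j hij x hx ↦ by
    rw [hKu x hx, (hUw x hx i).2.2.2 j hij, map_zero]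
  have hne : ∀ x ∈ U, ∀ i, u i x ≠ 0 := fun x hx i h ↦ (hUw x hx i).2.1 (by
    rw [← hsymm' x (hUb x hx) (w i (extChartAt I p x))]
    exact (congrArg _ h).trans (map_zero _))
  have hli : ∀ x ∈ U, LinearIndependent ℝ (u · x) := fun x hx ↦
    linearIndependent_of_orthogonal_idempotents
      (LinearMap.mk₂ ℝ (fun u v ↦ S.K x u v) (by simp) (by simp) (by simp) (by simp))
      (hne x hx) (fun i ↦ hidem i x hx) (fun i j hij ↦ horth i j hij x hx)
  refine ⟨U, hUo, hpU, u, ⟨fun {x} hx ↦ hli x hx, fun {x} hx ↦ ?_, fun i ↦ ?_⟩, hidem, horth⟩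
  · refine ((hli x hx).span_eq_top_of_card_eq_finrank' ?_).ge
    rw [Fintype.card_fin]
    rfl
  · rw [e.contMDiffOn_section_iff hUo hUb]
    have h : ContMDiffOn I 𝓘(ℝ, E) ∞ (fun x ↦ w i (φ x)) U := fun x hx ↦ by
      have h1 : ContMDiffAt 𝓘(ℝ, E) 𝓘(ℝ, E) ∞ (w i) (φ x) := (hUw x hx i).1.contMDiffAt
      have h2 : ContMDiffAt I 𝓘(ℝ, E) ∞ φ x := contMDiffAt_extChartAt' (by
        rw [← extChartAt_source I]; exact (hUsub hx).1)
      exact (h1.comp x h2).contMDiffWithinAt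
    refine h.congr fun x hx ↦ ?_
    rw [← e.continuousLinearMapAt_apply_of_mem (R := ℝ) (hUb x hx)]
    exact hsymm' x (hUb x hx) _

end StatisticalStructure

section

variable {E : Type*} [NormedAddCommGroup E] [NormedSpace ℝ E]
  {H : Type*} [TopologicalSpace H] {I : ModelWithCorners ℝ E H}
  {M : Type*} [TopologicalSpace M] [ChartedSpace H M]

theorem mvfderiv_congr {f h : M → ℝ} {x : M} (hfh : f =ᶠ[𝓝 x] h) :
    mvfderiv I f x = mvfderiv I h x := by
  ext v
  exact congrArg (fun A : TangentSpace I x →L[ℝ] ℝ ↦ A v) (hfh.mfderiv_eq (I := I))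

theorem mdifferentiableAt_fun_sum {ι : Type*} {s : Finset ι} {f : ι → M → ℝ} {x : M}
    (hf : ∀ i ∈ s, MDiffAt (f i) x) : MDiffAt (fun y ↦ ∑ i ∈ s, f i y) x := by
  classical
  induction s using Finset.induction_on with
  | empty => simpa using mdifferentiableAt_const
  | insert a s ha ih =>
    simp only [Finset.sum_insert ha]
    exact (hf a (Finset.mem_insert_self _ _)).add
      (ih fun i hi ↦ hf i (Finset.mem_insert_of_mem hi))

theorem mvfderiv_fun_sum {ι : Type*} {s : Finset ι} {f : ι → M → ℝ} {x : M}
    (hf : ∀ i ∈ s, MDiffAt (f i) x) :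
    mvfderiv I (fun y ↦ ∑ i ∈ s, f i y) x = ∑ i ∈ s, mvfderiv I (f i) x := by
  classical
  induction s using Finset.induction_on with
  | empty => simp [mvfderiv_const]
  | insert a s ha ih =>
    have hs : ∀ i ∈ s, MDiffAt (f i) x := fun i hi ↦ hf i (Finset.mem_insert_of_mem hi)
    simp only [Finset.sum_insert ha]
    rw [mvfderiv_fun_add (hf a (Finset.mem_insert_self _ _)) (mdifferentiableAt_fun_sum hs), ih hs]

end

namespace StatisticalStructure

set_option linter.unusedSectionVars false

variable {E : Type*} [NormedAddCommGroup E] [NormedSpace ℝ E] [FiniteDimensional ℝ E]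
  {H : Type*} [TopologicalSpace H] {I : ModelWithCorners ℝ E H}
  {M : Type*} [TopologicalSpace M] [ChartedSpace H M] [IsManifold I ∞ M]
  {S : StatisticalStructure I M}

theorem C_comm_left (x : M) (u v w : TangentSpace I x) : S.C x u v w = S.C x v u w :=
  S.symm_left x u v w

theorem C_comm_right (x : M) (u v w : TangentSpace I x) : S.C x u v w = S.C x u w v :=
  S.symm_right x u v w

theorem isUnit_det_gram (x : M) : IsUnit (S.gram x).det := by
  rw [isUnit_iff_ne_zero]
  intro h
  obtain ⟨c, hc, hc0⟩ := Matrix.exists_mulVec_eq_zero_iff.2 h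
  have hv : ∑ i, c i • (tangentBasis x i : TangentSpace I x) ≠ 0 := fun h0 ↦ hc
    (funext (Fintype.linearIndependent_iff.1 (tangentBasis (I := I) x).linearIndependent c h0))
  have hpos := S.g.pos x _ hv
  have hz : S.g.inner x (∑ i, c i • (tangentBasis x i : TangentSpace I x))
      (∑ i, c i • (tangentBasis x i : TangentSpace I x)) = ∑ i, c i * ((S.gram x).mulVec c i) := by
    simp only [map_sum, map_smul, sum_apply, smul_apply, smul_eq_mul,
      Matrix.mulVec, dotProduct, gram, Matrix.of_apply, Finset.mul_sum]
    rw [Finset.sum_comm]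
    refine Finset.sum_congr rfl fun i _ ↦ Finset.sum_congr rfl fun j _ ↦ ?_
    ring
  rw [hz, hc0] at hpos
  simp at hpos

namespace IsCanonicalFrameOn

variable {ι : Type*} {u : ι → Π x : M, TangentSpace I x} {U : Set M}
  (hu : S.IsCanonicalFrameOn u U) {x : M} (hx : x ∈ U)

include hu hx

theorem inner_self_pos (i : ι) : 0 < S.g.inner x (u i x) (u i x) :=
  S.g.pos x _ ((hu.isLocalFrameOn.linearIndependent hx).ne_zero i)

theorem inner_eq_zero {i j : ι} (hij : i ≠ j) : S.g.inner x (u i x) (u j x) = 0 := by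
  rw [← hu.idem i x hx, S.symm_right, hu.orth i j hij x hx, map_zero, zero_apply]

theorem eq_sum [Fintype ι] (v : TangentSpace I x) :
    v = ∑ i, (S.g.inner x v (u i x) / S.g.inner x (u i x) (u i x)) • u i x := by
  classical
  let b := hu.isLocalFrameOn.toBasisAt hx
  have hv : v = ∑ i, b.repr v i • u i x := by
    conv_lhs => rw [← b.sum_repr v]
    exact Finset.sum_congr rfl fun i _ ↦ by rw [hu.isLocalFrameOn.toBasisAt_coe hx]
  have hc : ∀ i, S.g.inner x v (u i x) = b.repr v i * S.g.inner x (u i x) (u i x) := by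
    intro i
    conv_lhs => rw [hv]
    simp only [map_sum, map_smul, sum_apply, smul_apply, smul_eq_mul]
    refine Finset.sum_eq_single i (fun j _ hj ↦ ?_) (fun h ↦ absurd (Finset.mem_univ i) h)
    rw [hu.inner_eq_zero hx hj, mul_zero]
  conv_lhs => rw [hv]
  refine Finset.sum_congr rfl fun i _ ↦ ?_
  rw [hc, mul_div_cancel_right₀ _ (hu.inner_self_pos hx i).ne']

theorem ext_inner [Fintype ι] {v w : TangentSpace I x}
    (h : ∀ i, S.g.inner x v (u i x) = S.g.inner x w (u i x)) : v = w := by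
  rw [hu.eq_sum hx v, hu.eq_sum hx w]
  simp only [h]

theorem clm_eq_zero [Fintype ι] {F : Type*} [AddCommGroup F] [Module ℝ F] [TopologicalSpace F]
    {A : TangentSpace I x →L[ℝ] F} (h : ∀ i, A (u i x) = 0) : A = 0 := by
  ext v
  rw [hu.eq_sum hx v, map_sum]
  simp [h]

theorem K_frame_apply [Fintype ι] (i : ι) (v : TangentSpace I x) :
    S.K x (u i x) v = (S.g.inner x v (u i x) / S.g.inner x (u i x) (u i x)) • u i x := by
  conv_lhs => rw [hu.eq_sum hx v]
  rw [map_sum]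
  refine (Finset.sum_eq_single i (fun j _ hj ↦ ?_) (fun h ↦ absurd (Finset.mem_univ i) h)).trans ?_
  · rw [map_smul, hu.orth i j hj.symm x hx, smul_zero]
  · rw [map_smul, hu.idem i x hx]

theorem C_frame_self (i : ι) (v : TangentSpace I x) :
    S.C x (u i x) (u i x) v = S.g.inner x (u i x) v := by
  rw [C, hu.idem i x hx]

theorem C_frame_ne {i j : ι} (hij : i ≠ j) (v : TangentSpace I x) :
    S.C x (u i x) (u j x) v = 0 := by
  rw [C, hu.orth i j hij x hx, map_zero, zero_apply]

theorem C_eq_sum [Fintype ι] (v w z : TangentSpace I x) :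
    S.C x v w z = ∑ i, (S.g.inner x v (u i x) * (S.g.inner x w (u i x) * S.g.inner x z (u i x))) /
      S.g.inner x (u i x) (u i x) ^ 2 := by
  rw [C]
  conv_lhs => rw [hu.eq_sum hx v]
  simp only [map_sum, map_smul, sum_apply, smul_apply, smul_eq_mul]
  refine Finset.sum_congr rfl fun i _ ↦ ?_
  rw [hu.K_frame_apply hx, map_smul, smul_apply, S.g.symm x _ z, smul_eq_mul]
  have := (hu.inner_self_pos hx i).ne'
  field_simp

/-- The trace field pairs to `1` with every member of a canonical frame. -/
theorem inner_traceField [Fintype ι] (l : ι) : S.g.inner x (S.traceField x) (u l x) = 1 := by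
  let b := tangentBasis (I := I) x
  let c := b.repr (u l x)
  let p := fun i ↦ S.g.inner x (b i) (u l x)
  have hul : u l x = ∑ i, c i • b i := (b.sum_repr _).symm
  have hp : (S.gram x).mulVec c = p := by
    ext i
    simp only [p]
    rw [hul]
    simp only [map_sum, map_smul, smul_eq_mul, Matrix.mulVec, dotProduct, gram, Matrix.of_apply]
    exact Finset.sum_congr rfl fun j _ ↦ mul_comm _ _
  have hc : (S.gram x)⁻¹.mulVec p = c := by
    rw [← hp, Matrix.mulVec_mulVec, Matrix.nonsing_inv_mul _ (isUnit_det_gram x), Matrix.one_mulVec]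
  have hpos := hu.inner_self_pos hx l
  have hKb : ∀ i j, S.g.inner x (S.K x (b i) (b j)) (u l x) =
      p i * p j / S.g.inner x (u l x) (u l x) := by
    intro i j
    rw [S.symm_right, S.K_comm, hu.K_frame_apply hx, map_smul, smul_apply, S.g.symm x (u l x) (b j),
      smul_eq_mul]
    simp only [p]
    ring
  have hself : S.g.inner x (u l x) (u l x) = ∑ i, p i * c i := by
    conv_lhs => enter [1, 2]; rw [hul]
    simp only [map_sum, map_smul, sum_apply, smul_apply, smul_eq_mul]
    exact Finset.sum_congr rfl fun j _ ↦ mul_comm _ _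
  calc S.g.inner x (S.traceField x) (u l x)
      = ∑ i, ∑ j, (S.gram x)⁻¹ i j * (p i * p j / S.g.inner x (u l x) (u l x)) := by
        simp only [traceField, map_sum, map_smul, sum_apply, smul_apply,
          smul_eq_mul]
        refine Finset.sum_congr rfl fun i _ ↦ Finset.sum_congr rfl fun j _ ↦ ?_
        rw [← hKb]
    _ = (∑ i, p i * (S.gram x)⁻¹.mulVec p i) / S.g.inner x (u l x) (u l x) := by
        simp only [Matrix.mulVec, dotProduct, Finset.mul_sum, Finset.sum_div]
        refine Finset.sum_congr rfl fun i _ ↦ Finset.sum_congr rfl fun j _ ↦ ?_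
        ring
    _ = 1 := by
        rw [hc, ← hself, div_self hpos.ne']

end IsCanonicalFrameOn

end StatisticalStructure

/-- Connection coefficients `Γ k i j = g(∇̂_{u_k} u_i, u_j)` of a canonical frame vanish if the
components `N` of `∇̂C` are totally symmetric and the trace field is parallel. -/
theorem connection_coeff_eq_zero {ι : Type*} [Fintype ι] {a : ι → ℝ} {Γ : ι → ι → ι → ℝ}
    {N : ι → ι → ι → ι → ℝ} (ha : ∀ i, 0 < a i) (hΓ : ∀ k i j, i ≠ j → Γ k i j + Γ k j i = 0)
    (s₁ : ∀ k i j l, N k i j l = N i k j l) (s₂ : ∀ k i j l, N k i j l = N k j i l)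
    (s₃ : ∀ k i j l, N k i j l = N k i l j) (n₁ : ∀ k i, N k i i i = -Γ k i i)
    (n₂ : ∀ k i j, i ≠ j → N k i i j = Γ k i j)
    (n₃ : ∀ k i j l, i ≠ j → i ≠ l → j ≠ l → N k i j l = 0)
    (hE : ∀ k i, ∑ j, Γ k i j / a j = 0) (k i j : ι) : Γ k i j = 0 := by
  have d : ∀ k i j, k ≠ i → k ≠ j → i ≠ j → Γ k i j = 0 := fun k i j h1 h2 h3 ↦ by
    rw [← n₂ k i j h3, s₁, n₃ _ _ _ _ h1 h2 h3]
  have e1 : ∀ i j, i ≠ j → Γ i i j = -Γ j i i := fun i j h ↦ by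
    rw [← n₂ i i j h, s₃, s₂, s₁, n₁]
  have e2 : ∀ i j, i ≠ j → Γ j i j = Γ j i i := fun i j h ↦ by
    have h1 : Γ j i j = Γ i j i := by rw [← n₂ j i j h, s₁, s₃, n₂ _ _ _ h.symm]
    have h2 := hΓ i i j h
    have h3 := e1 i j h
    linarith
  have e3 : ∀ k i, k ≠ i → Γ k i i = 0 := fun k i h ↦ by
    have h1 := hE k i
    rw [Fintype.sum_eq_add i k h.symm (fun j hj ↦ by
      rw [d k i j h hj.2.symm hj.1.symm, zero_div]), e2 i k h.symm] at h1
    have h2 : Γ k i i * (1 / a i + 1 / a k) = 0 := by rw [← h1]; ring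
    refine (mul_eq_zero.1 h2).resolve_right ?_
    have := ha i
    have := ha k
    positivity
  have e4 : ∀ i, Γ i i i = 0 := fun i ↦ by
    have h1 := hE i i
    rw [Fintype.sum_eq_single i (fun j hj ↦ by
      rw [e1 i j hj.symm, e3 j i hj, neg_zero, zero_div])] at h1
    exact (div_eq_zero_iff.1 h1).resolve_right (ha i).ne'
  by_cases hij : i = j
  · subst hij
    by_cases hki : k = i
    · subst hki; exact e4 k
    · exact e3 k i hki
  · by_cases hki : k = i
    · subst hki; rw [e1 k j hij, e3 j k (Ne.symm hij), neg_zero]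
    · by_cases hkj : k = j
      · subst hkj; rw [e2 i k hij, e3 k i hki]
      · exact d k i j hki hkj hij

namespace StatisticalStructure

set_option linter.unusedSectionVars false

variable {E : Type*} [NormedAddCommGroup E] [NormedSpace ℝ E] [FiniteDimensional ℝ E]
  {H : Type*} [TopologicalSpace H] {I : ModelWithCorners ℝ E H}
  {M : Type*} [TopologicalSpace M] [ChartedSpace H M] [IsManifold I ∞ M]
  {S : StatisticalStructure I M}

namespace IsCanonicalFrameOn

variable {ι : Type*} {u : ι → Π x : M, TangentSpace I x} {U : Set M}
  (hu : S.IsCanonicalFrameOn u U) (hU : IsOpen U) {x : M} (hx : x ∈ U)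

include hu hU hx

theorem mdifferentiableAt (i : ι) : MDiffAt (T% (u i)) x :=
  (hu.isLocalFrameOn.contMDiffAt hU hx i).mdifferentiableAt (by simp)

theorem mvfderiv_inner_self (k i : ι) :
    mvfderiv I (fun y ↦ S.g.inner y (u i y) (u i y)) x (u k x) =
      2 * S.g.inner x (leviCivita S.g (u i) x (u k x)) (u i x) := by
  have hd := hu.mdifferentiableAt hU hx
  rw [leviCivita_metric S.g (hd k) (hd i) (hd i), S.g.symm x (u i x)]
  ring

theorem inner_leviCivita_add {k i j : ι} (hij : i ≠ j) :
    S.g.inner x (leviCivita S.g (u i) x (u k x)) (u j x) +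
      S.g.inner x (leviCivita S.g (u j) x (u k x)) (u i x) = 0 := by
  have hd := hu.mdifferentiableAt hU hx
  have h := leviCivita_metric S.g (hd k) (hd i) (hd j)
  have h0 : (fun y ↦ S.g.inner y (u i y) (u j y)) =ᶠ[𝓝 x] fun _ ↦ (0 : ℝ) := by
    filter_upwards [hU.mem_nhds hx] with y hy using hu.inner_eq_zero hy hij
  rw [mvfderiv_congr h0, mvfderiv_const, zero_apply, S.g.symm x (u i x)] at h
  exact h.symm

theorem nablaC_self (k i : ι) :
    S.nablaC (u k) (u i) (u i) (u i) x =
      -S.g.inner x (leviCivita S.g (u i) x (u k x)) (u i x) := by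
  have h0 : (fun y ↦ S.C y (u i y) (u i y) (u i y)) =ᶠ[𝓝 x]
      fun y ↦ S.g.inner y (u i y) (u i y) := by
    filter_upwards [hU.mem_nhds hx] with y hy using hu.C_frame_self hy i _
  have e : ∀ v, S.C x (u i x) v (u i x) = S.g.inner x v (u i x) := fun v ↦ by
    rw [C_comm_right, hu.C_frame_self hx, S.g.symm]
  rw [nablaC, mvfderiv_congr h0, hu.mvfderiv_inner_self hU hx, C_comm_left x _ (u i x) (u i x), e,
    hu.C_frame_self hx, S.g.symm x (u i x)]
  ring

theorem nablaC_pair {k i j : ι} (hij : i ≠ j) :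
    S.nablaC (u k) (u i) (u i) (u j) x =
      S.g.inner x (leviCivita S.g (u i) x (u k x)) (u j x) := by
  have h0 : (fun y ↦ S.C y (u i y) (u i y) (u j y)) =ᶠ[𝓝 x] fun _ ↦ (0 : ℝ) := by
    filter_upwards [hU.mem_nhds hx] with y hy
    rw [hu.C_frame_self hy, hu.inner_eq_zero hy hij]
  have e : ∀ v, S.C x (u i x) v (u j x) = 0 := fun v ↦ by
    rw [C_comm_right, hu.C_frame_ne hx hij]
  have h := hu.inner_leviCivita_add hU hx (k := k) hij
  rw [nablaC, mvfderiv_congr h0, mvfderiv_const, zero_apply, C_comm_left x _ (u i x) (u j x),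
    e, hu.C_frame_self hx, S.g.symm x (u i x)]
  linarith

theorem nablaC_ne {k i j l : ι} (hij : i ≠ j) (hil : i ≠ l) (hjl : j ≠ l) :
    S.nablaC (u k) (u i) (u j) (u l) x = 0 := by
  have h0 : (fun y ↦ S.C y (u i y) (u j y) (u l y)) =ᶠ[𝓝 x] fun _ ↦ (0 : ℝ) := by
    filter_upwards [hU.mem_nhds hx] with y hy using hu.C_frame_ne hy hij _
  have e1 : ∀ v, S.C x v (u j x) (u l x) = 0 := fun v ↦ by
    rw [C_comm_left, C_comm_right, hu.C_frame_ne hx hjl]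
  have e2 : ∀ v, S.C x (u i x) v (u l x) = 0 := fun v ↦ by
    rw [C_comm_right, hu.C_frame_ne hx hil]
  rw [nablaC, mvfderiv_congr h0, mvfderiv_const, zero_apply, e1, e2, hu.C_frame_ne hx hij]
  simp

variable [Fintype ι]

theorem mdifferentiableAt_traceField : MDiffAt (T% S.traceField) x := by
  have hd := hu.mdifferentiableAt hU hx
  have h1 : MDiffAt (T% (fun y ↦ ∑ i, (fun z ↦ (S.g.inner z (u i z) (u i z))⁻¹) y • u i y)) x := by
    refine MDifferentiableAt.sum_section fun i _ ↦ ?_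
    exact ((mdifferentiableAt_metric S.g (hd i) (hd i)).inv
      (hu.inner_self_pos hx i).ne').smul_section (hd i)
  refine h1.congr_of_eventuallyEq ?_
  filter_upwards [hU.mem_nhds hx] with y hy
  congr 1
  rw [hu.eq_sum hy (S.traceField y)]
  refine Finset.sum_congr rfl fun i _ ↦ ?_
  rw [hu.inner_traceField hy, one_div]

theorem inner_leviCivita_traceField (k i : ι) :
    S.g.inner x (leviCivita S.g S.traceField x (u k x)) (u i x) +
      ∑ j, S.g.inner x (leviCivita S.g (u i) x (u k x)) (u j x) /
        S.g.inner x (u j x) (u j x) = 0 := by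
  have hd := hu.mdifferentiableAt hU hx
  have h := leviCivita_metric S.g (hd k) (hu.mdifferentiableAt_traceField hU hx) (hd i)
  have h0 : (fun y ↦ S.g.inner y (S.traceField y) (u i y)) =ᶠ[𝓝 x] fun _ ↦ (1 : ℝ) := by
    filter_upwards [hU.mem_nhds hx] with y hy using hu.inner_traceField hy i
  rw [mvfderiv_congr h0, mvfderiv_const, zero_apply] at h
  rw [h]
  congr 1
  conv_rhs => rw [hu.eq_sum hx (leviCivita S.g (u i) x (u k x))]
  simp only [map_sum, map_smul, smul_eq_mul, hu.inner_traceField hx, mul_one]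

theorem leviCivita_eq_zero_of_inner {i : ι}
    (h : ∀ k j, S.g.inner x (leviCivita S.g (u i) x (u k x)) (u j x) = 0) :
    leviCivita S.g (u i) x = 0 :=
  hu.clm_eq_zero hx fun k ↦ hu.ext_inner hx fun j ↦ by rw [h, map_zero, zero_apply]

theorem leviCivita_traceField_eq_zero (h : ∀ i, leviCivita S.g (u i) x = 0) :
    leviCivita S.g S.traceField x = 0 := by
  refine hu.clm_eq_zero hx fun k ↦ hu.ext_inner hx fun i ↦ ?_
  have h1 := hu.inner_leviCivita_traceField hU hx k i
  simpa [h] using h1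

theorem mvfderiv_inner_self_eq_zero {i : ι} (h : leviCivita S.g (u i) x = 0) :
    mvfderiv I (fun y ↦ S.g.inner y (u i y) (u i y)) x = 0 :=
  hu.clm_eq_zero hx fun k ↦ by rw [hu.mvfderiv_inner_self hU hx, h]; simp

/-- A canonical frame is parallel where `∇̂C` vanishes. -/
theorem leviCivita_eq_zero_of_nablaC (h : S.NablaCEqZero) (i : ι) :
    leviCivita S.g (u i) x = 0 := by
  have hd := hu.mdifferentiableAt hU hx
  refine hu.leviCivita_eq_zero_of_inner hU hx fun k j ↦ ?_
  by_cases hij : i = j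
  · subst hij
    rw [← neg_eq_zero, ← hu.nablaC_self hU hx]
    exact h x _ _ _ _ (hd k) (hd i) (hd i) (hd i)
  · rw [← hu.nablaC_pair hU hx hij]
    exact h x _ _ _ _ (hd k) (hd i) (hd i) (hd j)

/-- A canonical frame is parallel if `∇̂C` is totally symmetric and the trace field is parallel. -/
theorem leviCivita_eq_zero_of_symmetric (h : S.NablaCSymmetric)
    (hE : leviCivita S.g S.traceField x = 0) (i : ι) : leviCivita S.g (u i) x = 0 := by
  have hd := hu.mdifferentiableAt hU hx
  have hs := fun k i j l ↦ h x (u k) (u i) (u j) (u l) (hd k) (hd i) (hd j) (hd l)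
  refine hu.leviCivita_eq_zero_of_inner hU hx fun k j ↦ ?_
  refine connection_coeff_eq_zero (hu.inner_self_pos hx)
    (Γ := fun k i j ↦ S.g.inner x (leviCivita S.g (u i) x (u k x)) (u j x))
    (N := fun k i j l ↦ S.nablaC (u k) (u i) (u j) (u l) x)
    (fun k i j hij ↦ hu.inner_leviCivita_add hU hx hij)
    (fun k i j l ↦ (hs k i j l).1) (fun k i j l ↦ (hs k i j l).2.1)
    (fun k i j l ↦ (hs k i j l).2.2) (hu.nablaC_self hU hx)
    (fun k i j hij ↦ hu.nablaC_pair hU hx hij)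
    (fun k i j l h1 h2 h3 ↦ hu.nablaC_ne hU hx h1 h2 h3) (fun k i ↦ ?_) k i j
  have h1 := hu.inner_leviCivita_traceField hU hx k i
  simpa [hE] using h1

theorem nablaC_eq_zero_of_parallel [I.Boundaryless]
    (h : ∀ y ∈ U, ∀ i, leviCivita S.g (u i) y = 0) {W X Y Z : Π x : M, TangentSpace I x}
    (hW : MDiffAt (T% W) x) (hX : MDiffAt (T% X) x) (hY : MDiffAt (T% Y) x)
    (hZ : MDiffAt (T% Z) x) : S.nablaC W X Y Z x = 0 := by
  have hd := hu.mdifferentiableAt hU hx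
  have hconst : ∀ᶠ y in 𝓝 x, ∀ i, S.g.inner y (u i y) (u i y) = S.g.inner x (u i x) (u i x) :=
    Filter.eventually_all.2 fun i ↦ eventually_eq_of_mvfderiv_eq_zero hU
      (f := fun y ↦ S.g.inner y (u i y) (u i y))
      (fun y hy ↦ mdifferentiableAt_metric S.g (hu.mdifferentiableAt hU hy i)
        (hu.mdifferentiableAt hU hy i))
      (fun y hy ↦ hu.mvfderiv_inner_self_eq_zero hU hy (h y hy i)) hx
  have h0 : (fun y ↦ S.C y (X y) (Y y) (Z y)) =ᶠ[𝓝 x] fun y ↦ ∑ i,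
      (S.g.inner x (u i x) (u i x) ^ 2)⁻¹ * (S.g.inner y (X y) (u i y) *
        (S.g.inner y (Y y) (u i y) * S.g.inner y (Z y) (u i y))) := by
    filter_upwards [hU.mem_nhds hx, hconst] with y hy hc
    rw [hu.C_eq_sum hy]
    refine Finset.sum_congr rfl fun i _ ↦ ?_
    rw [hc, div_eq_inv_mul]
  have dm : ∀ {V : Π x : M, TangentSpace I x} (_ : MDiffAt (T% V) x) (i : ι),
      MDiffAt (fun y ↦ S.g.inner y (V y) (u i y)) x := fun hV i ↦
    mdifferentiableAt_metric S.g hV (hd i)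
  have dv : ∀ {V : Π x : M, TangentSpace I x} (_ : MDiffAt (T% V) x) (i : ι),
      mvfderiv I (fun y ↦ S.g.inner y (V y) (u i y)) x (W x) =
        S.g.inner x (leviCivita S.g V x (W x)) (u i x) := fun hV i ↦ by
    rw [leviCivita_metric S.g hW hV (hd i), h x hx i]
    simp
  have d2 : ∀ i, MDiffAt (fun y ↦ S.g.inner y (Y y) (u i y) * S.g.inner y (Z y) (u i y)) x :=
    fun i ↦ (dm hY i).mul (dm hZ i)
  have d3 : ∀ i, MDiffAt (fun y ↦ S.g.inner y (X y) (u i y) *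
      (S.g.inner y (Y y) (u i y) * S.g.inner y (Z y) (u i y))) x := fun i ↦ (dm hX i).mul (d2 i)
  have dc : ∀ i, MDiffAt (fun _ : M ↦ (S.g.inner x (u i x) (u i x) ^ 2)⁻¹) x := fun i ↦
    mdifferentiableAt_const
  have d4 : ∀ i, MDiffAt (fun y ↦ (S.g.inner x (u i x) (u i x) ^ 2)⁻¹ * (S.g.inner y (X y) (u i y) *
      (S.g.inner y (Y y) (u i y) * S.g.inner y (Z y) (u i y)))) x := fun i ↦ (dc i).mul (d3 i)
  rw [nablaC, mvfderiv_congr h0, mvfderiv_fun_sum fun i _ ↦ d4 i, hu.C_eq_sum hx,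
    hu.C_eq_sum hx, hu.C_eq_sum hx, sum_apply, ← Finset.sum_sub_distrib, ← Finset.sum_sub_distrib,
    ← Finset.sum_sub_distrib]
  refine Finset.sum_eq_zero fun i _ ↦ ?_
  have e1 := mvfderiv_fun_mul (dc i) (d3 i)
  have e2 := mvfderiv_fun_mul (dm hX i) (d2 i)
  have e3 := mvfderiv_fun_mul (dm hY i) (dm hZ i)
  rw [e1, e2, e3, mvfderiv_const]
  simp only [add_apply, smul_apply, smul_eq_mul, dv hX, dv hY, dv hZ, zero_apply]
  ring

end IsCanonicalFrameOn

end StatisticalStructure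

end StatGeom

theorem corollary3p13 {n : ℕ} {M : Type*} [TopologicalSpace M]
    [ChartedSpace (EuclideanSpace ℝ (Fin n)) M] [IsManifold (𝓡 n) ∞ M]
    (S : StatGeom.StatisticalStructure (𝓡 n) M)
    (hK : S.IsNondegenerate)
    (hKK : ∀ (x : M) (v w z : TangentSpace (𝓡 n) x), S.bracketKK x v w z = 0) :
    (∀ p : M, ∃ U : Set M, IsOpen U ∧ p ∈ U ∧
      ∃ u : Fin n → Π x : M, TangentSpace (𝓡 n) x, S.IsCanonicalFrameOn u U) ∧
    ((S.NablaCSymmetric ∧ ∀ x : M, StatGeom.leviCivita S.g S.traceField x = 0) ↔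
      (S.NablaCEqZero ∧
        ∀ U : Set M, IsOpen U → IsPreconnected U →
          ∀ u : Fin n → Π x : M, TangentSpace (𝓡 n) x, S.IsCanonicalFrameOn u U →
            ∀ i : Fin n, ∃ c : ℝ, ∀ x ∈ U, S.g.inner x (u i x) (u i x) = c)) := by
  have hex : ∀ p : M, ∃ U : Set M, IsOpen U ∧ p ∈ U ∧
      ∃ u : Fin n → Π x : M, TangentSpace (𝓡 n) x, S.IsCanonicalFrameOn u U := by
    have h := S.exists_isCanonicalFrameOn hK hKK
    rwa [finrank_euclideanSpace_fin] at h
  refine ⟨hex, fun ⟨hs, hE⟩ ↦ ⟨fun x W X Y Z hW hX hY hZ ↦ ?_, fun U hU hUc u hu i ↦ ?_⟩,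
    fun ⟨h0, _⟩ ↦ ⟨fun x W X Y Z hW hX hY hZ ↦ ?_, fun x ↦ ?_⟩⟩
  · obtain ⟨U, hU, hx, u, hu⟩ := hex x
    exact hu.nablaC_eq_zero_of_parallel hU hx
      (fun y hy ↦ hu.leviCivita_eq_zero_of_symmetric hU hy hs (hE y)) hW hX hY hZ
  · exact StatGeom.exists_const_of_mvfderiv_eq_zero hU hUc
      (fun x hx ↦ StatGeom.mdifferentiableAt_metric S.g (hu.mdifferentiableAt hU hx i)
        (hu.mdifferentiableAt hU hx i))
      (fun x hx ↦ hu.mvfderiv_inner_self_eq_zero hU hx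
        (hu.leviCivita_eq_zero_of_symmetric hU hx hs (hE x) i))
  · rw [h0 x W X Y Z hW hX hY hZ, h0 x X W Y Z hX hW hY hZ, h0 x W Y X Z hW hY hX hZ,
      h0 x W X Z Y hW hX hZ hY]
    exact ⟨rfl, rfl, rfl⟩
  · obtain ⟨U, hU, hx, u, hu⟩ := hex x
    exact hu.leviCivita_traceField_eq_zero hU hx (hu.leviCivita_eq_zero_of_nablaC hU hx h0)
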